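/- The machine model is a deterministic random access machine with a finite program and a fixed finite number of registers holding natural numbers, initially all $0$ except for one that holds $n$. Its instructions are: load a constant; copy; $+$, truncated $-$, $\times$ and integer $\div$ of registers; branch on $\le$; halt; and queries, which place the character $s[i]$ or $\bar s[i]$ into a register, where $i$ is the content of a register. The two input strings are read-only and are not counted as memory. The memory used by a run is the maximum, over all moments of the run, of the total number of bits of the binary representations of the contents of all registers (including any stored characters). For strings $s,\bar s$ over $\mathbb{N}$, $\mathrm{lcs}(s,\bar s)$ is the maximum length of a string that is a subsequence of both, and $\mathrm{ed}(s,\bar s)$ is the minimum number of character insertions, deletions and substitutions that transform $s$ into $\bar s$. Theorem. There are two such machines $M_1$ and $M_2$, independent of all parameters, such that for every $k\in\mathbb{N}$ there is a constant $C$ for which the following holds. For every $n\ge 0$ and all strings $s,\bar s$ of length $n$ whose characters are natural numbers less than $(n+2)^k$ (that is, over an alphabet of size polynomial in $n$, which includes every fixed finite alphabet), given random access to $s$ and $\bar s$, the machine $M_1$ halts with output $\mathrm{lcs}(s,\bar s)$ and $M_2$ halts with output $\mathrm{ed}(s,\bar s)$, and each of them uses at most $C\,\lfloor\log_2 (n+2)\rfloor^2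 = O(\log^2 n)$ bits of memory. -/

import Mathlib

/-! ## Strings: longest common subsequence and edit distance -/

/-- The length of a longest common subsequence of two strings
(`List.Sublist`, written `<+`, is the subsequence relation). -/
noncomputable def lcs {α : Type*} (s t : List α) : ℕ :=
  sSup {k : ℕ | ∃ u : List α, u.Sublist s ∧ u.Sublist t ∧ u.length = k}

/-- One edit operation: inserting, deleting or substituting a single character. -/
inductive EditStep {α : Type*} : List α → List α → Prop
  | insert (u v : List α) (a : α) : EditStep (u ++ v) (u ++ a :: v)
  | delete (u v : List α) (a : α) : EditStep (u ++ a :: v) (u ++ v)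
  | substitute (u v : List α) (a b : α) : EditStep (u ++ a :: v) (u ++ b :: v)

/-- `EditsIn k s t`: the string `s` can be turned into `t` by exactly `k` edit operations. -/
inductive EditsIn {α : Type*} : ℕ → List α → List α → Prop
  | refl (s : List α) : EditsIn 0 s s
  | tail {k : ℕ} {s t u : List α} : EditsIn k s t → EditStep t u → EditsIn (k + 1) s u

/-- The edit distance: the least number of character insertions, deletions and substitutions
that transform `s` into `t`. -/
noncomputable def ed {α : Type*} (s t : List α) : ℕ :=
  sInf {k : ℕ | EditsIn k s t}

/-- The set whose supremum is `lcs s t` is bounded. -/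
theorem lcs_bddAbove {α : Type*} (s t : List α) :
    BddAbove {k : ℕ | ∃ u : List α, u.Sublist s ∧ u.Sublist t ∧ u.length = k} := by
  refine ⟨s.length, ?_⟩
  rintro k ⟨u, hs, -, rfl⟩
  exact hs.length_le

/-- Any string can be edited into any other one, so the infimum in `ed` is a minimum. -/
theorem exists_editsIn {α : Type*} (s t : List α) : ∃ k, EditsIn k s t := by
  have del : ∀ s : List α, ∃ k, EditsIn k (t ++ s) t := by
    intro s
    have h : ∀ (u w : List α) (k : ℕ), EditsIn k u (t ++ w) → ∃ k, EditsIn k u t := by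
      intro u w
      induction w with
      | nil => intro k hk; exact ⟨k, by simpa using hk⟩
      | cons a w ih => intro k hk; exact ih (k + 1) (hk.tail (.delete t w a))
    exact h _ s 0 (.refl _)
  have ins : ∀ u : List α, ∃ k, EditsIn k s (u ++ s) := by
    intro u
    induction u with
    | nil => exact ⟨0, .refl s⟩
    | cons a u ih =>
      obtain ⟨k, hk⟩ := ih
      exact ⟨k + 1, hk.tail (.insert [] (u ++ s) a)⟩
  have trans : ∀ {j k : ℕ} {a b c : List α}, EditsIn j a b → EditsIn k b c →
      ∃ m, EditsIn m a c := by
    intro j k a b c h1 h2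
    induction h2 with
    | refl => exact ⟨j, h1⟩
    | tail _ hst ih =>
      obtain ⟨m, hm⟩ := ih h1
      exact ⟨m + 1, hm.tail hst⟩
  obtain ⟨i, hi⟩ := ins t
  obtain ⟨j, hj⟩ := del s
  exact trans hi hj

/-! ## Deterministic random access machines with random access to two strings

A machine has a finite control and a fixed finite set of registers holding natural numbers.  The
two input strings are read-only; a character is obtained by a query with its position.  Characters
are natural numbers and have to be stored in a register when they are read.  Memory is measured in
bits: it is the total binary length of the contents of all the registers (the logarithmic space
measure).  The input strings themselves are not part of the memory.  Every instruction can be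
carried out by a deterministic multitape Turing machine in work space linear in the binary lengths
of the numbers involved. -/

/-- Instructions of a machine with control states `Q` and registers `R`. -/
inductive Instr (Q R : Type) : Type
  /-- `dst := c` -/
  | const (dst : R) (c : ℕ) (next : Q)
  /-- `dst := src` -/
  | copy (dst src : R) (next : Q)
  /-- `dst := a + b` -/
  | add (dst a b : R) (next : Q)
  /-- `dst := max (a - b) 0` -/
  | sub (dst a b : R) (next : Q)
  /-- `dst := a * b` -/
  | mul (dst a b : R) (next : Q)
  /-- `dst := ⌊a / b⌋`, and `dst := 0` if `b = 0` -/
  | div (dst a b : R) (next : Q)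
  /-- query of the first string: `dst := s[idx]`, and `dst := 0` if the position does not exist
  (positions are counted from `0`) -/
  | readFst (dst idx : R) (next : Q)
  /-- query of the second string -/
  | readSnd (dst idx : R) (next : Q)
  /-- continue with `yes` if `a ≤ b` and with `no` otherwise -/
  | branchLe (a b : R) (yes no : Q)
  /-- stop -/
  | halt

/-- A deterministic machine: a finite control, finitely many registers, and a program. -/
structure Machine where
  /-- control states -/
  Q : Type
  [finQ : Fintype Q]
  /-- registers -/
  R : Type
  [finR : Fintype R]
  [decR : DecidableEq R]
  /-- the initial control state -/
  start : Q
  /-- the register that initially holds the length `n` of the input strings -/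
  inp : R
  /-- the register that holds the result when the machine stops -/
  out : R
  /-- the program -/
  prog : Q → Instr Q R

namespace Machine

attribute [instance] Machine.finQ Machine.finR Machine.decR

/-- A configuration: control state and register contents. -/
structure Config (M : Machine) where
  /-- current control state -/
  state : M.Q
  /-- current register contents -/
  regs : M.R → ℕ

/-- The memory, in bits, that is occupied in a configuration. -/
def Config.memory {M : Machine} (c : M.Config) : ℕ :=
  ∑ r, Nat.size (c.regs r)

/-- Store `v` in register `dst` and go to control state `q`. -/
def Config.put {M : Machine} (c : M.Config) (dst : M.R) (v : ℕ) (q : M.Q) : M.Config :=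
  ⟨q, Function.update c.regs dst v⟩

/-- One step of the machine on the input strings `s` and `t`; `none` means that it stops. -/
def step (M : Machine) (s t : List ℕ) (c : M.Config) : Option M.Config :=
  match M.prog c.state with
  | .const dst v q => some (c.put dst v q)
  | .copy dst a q => some (c.put dst (c.regs a) q)
  | .add dst a b q => some (c.put dst (c.regs a + c.regs b) q)
  | .sub dst a b q => some (c.put dst (c.regs a - c.regs b) q)
  | .mul dst a b q => some (c.put dst (c.regs a * c.regs b) q)
  | .div dst a b q => some (c.put dst (c.regs a / c.regs b) q)
  | .readFst dst i q => some (c.put dst (s.getD (c.regs i) 0) q)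
  | .readSnd dst i q => some (c.put dst (t.getD (c.regs i) 0) q)
  | .branchLe a b yes no => some ⟨if c.regs a ≤ c.regs b then yes else no, c.regs⟩
  | .halt => none

/-- The initial configuration for strings of length `n`. -/
def init (M : Machine) (n : ℕ) : M.Config :=
  ⟨M.start, Function.update (fun _ => 0) M.inp n⟩

/-- `M.Visits s t c`: the run of `M` on `s` and `t` (of length `s.length`) reaches `c`. -/
def Visits (M : Machine) (s t : List ℕ) (c : M.Config) : Prop :=
  Relation.ReflTransGen (fun a b => M.step s t a = some b) (M.init s.length) c

/-- On random access to the strings `s` and `t`, the machine stops with result `v`, and at every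
moment of the run it occupies at most `B` bits of memory. -/
def ComputesWithin (M : Machine) (s t : List ℕ) (v B : ℕ) : Prop :=
  (∃ c, M.Visits s t c ∧ M.step s t c = none ∧ c.regs M.out = v) ∧
    ∀ c, M.Visits s t c → c.memory ≤ B

end Machine

/-! Both quantities are least alignment costs. With mismatch cost `1` the least cost is `ed s t`;
with mismatch cost `2` the least cost `c` satisfies `2 * lcs s t + c = s.length + t.length`
(`isLeast_align_ed`, `isLeast_align_lcs`).

An alignment of cost `c` is a path from `(0, 0, 0)` to `(n, n, c)` in a graph whose vertices `(i, j,
c)` record two positions and the cost so far. Vertices are coded as numbers below `N`, which is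
polynomial in `n`, and an edge is tested with one query to each string. Carrying the cost in the
vertex turns minimisation into reachability (`savitch_alignEdge_iff`): the costs `0, 1, 2, ...` are
tested in turn, and the first success is the minimum.

Reachability is decided as in Savitch's theorem: a walk of length `2 ^ (h + 1)` is two walks of
length `2 ^ h` through a middle vertex, and all middle vertices are tried. The recursion depth is
`O(log n)`, and each level stores two endpoints, the middle vertex and a flag for the half under
test, in `O(log n)` bits. The whole stack is one number, four base-`N` digits per level, so the
largest register has `O(log² n)` bits (`computes_call`, `size_bound_le`). -/

/-! ## Alignments -/

/-- `Align p s t c`: there is an alignment of `s` and `t` of cost `c`, where an unaligned character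
costs `1`, two equal characters are aligned for free, and any two characters at cost `p`. -/
inductive Align {α : Type*} (p : ℕ) : List α → List α → ℕ → Prop
  | nil : Align p [] [] 0
  | left {s t : List α} {c : ℕ} (a : α) : Align p s t c → Align p (a :: s) t (c + 1)
  | right {s t : List α} {c : ℕ} (b : α) : Align p s t c → Align p s (b :: t) (c + 1)
  | mismatch {s t : List α} {c : ℕ} (a b : α) :
      Align p s t c → Align p (a :: s) (b :: t) (c + p)
  | equal {s t : List α} {c : ℕ} (a : α) : Align p s t c → Align p (a :: s) (a :: t) c

namespace Align

variable {α : Type*} {p : ℕ} {s t : List α} {c : ℕ}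

theorem refl (p : ℕ) : ∀ s : List α, Align p s s 0
  | [] => nil
  | a :: s => equal a (refl p s)

theorem nil_left (p : ℕ) : ∀ t : List α, Align p [] t t.length
  | [] => nil
  | b :: t => right b (nil_left p t)

theorem nil_right (p : ℕ) : ∀ s : List α, Align p s [] s.length
  | [] => nil
  | a :: s => left a (nil_right p s)

theorem append (h : Align p s t c) {s' t' : List α} {c' : ℕ} (h' : Align p s' t' c') :
    Align p (s ++ s') (t ++ t') (c + c') := by
  induction h with
  | nil => simpa using h'
  | left a _ ih => rw [Nat.add_right_comm]; exact left a ih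
  | right b _ ih => rw [Nat.add_right_comm]; exact right b ih
  | mismatch a b _ ih => rw [Nat.add_right_comm]; exact mismatch a b ih
  | equal a _ ih => exact equal a ih

/-- An edit acts at one place of the second string; cutting the alignment there leaves only the tail
to repair, and `append` glues the parts again. -/
theorem exists_of_append_right {t' u : List α} (h : Align p s u c) (hu : u = t ++ t') :
    ∃ s₁ s₂ c₁ c₂, s = s₁ ++ s₂ ∧ c = c₁ + c₂ ∧ Align p s₁ t c₁ ∧ Align p s₂ t' c₂ := by
  induction h generalizing t with
  | nil =>
    obtain ⟨rfl, rfl⟩ := List.append_eq_nil_iff.1 hu.symm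
    exact ⟨[], [], 0, 0, rfl, rfl, nil, nil⟩
  | left a _ ih =>
    obtain ⟨s₁, s₂, c₁, c₂, rfl, rfl, h₁, h₂⟩ := ih hu
    exact ⟨a :: s₁, s₂, c₁ + 1, c₂, rfl, by omega, h₁.left a, h₂⟩
  | right b h ih =>
    rcases t with _ | ⟨b', t⟩
    · obtain rfl : _ = t' := hu
      exact ⟨[], _, 0, _, rfl, (Nat.zero_add _).symm, nil, h.right b⟩
    · obtain ⟨rfl, hu'⟩ := List.cons_eq_cons.1 hu
      obtain ⟨s₁, s₂, c₁, c₂, rfl, rfl, h₁, h₂⟩ := ih hu'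
      exact ⟨s₁, s₂, c₁ + 1, c₂, rfl, by omega, h₁.right b, h₂⟩
  | mismatch a b h ih =>
    rcases t with _ | ⟨b', t⟩
    · obtain rfl : _ = t' := hu
      exact ⟨[], _, 0, _, rfl, (Nat.zero_add _).symm, nil, h.mismatch a b⟩
    · obtain ⟨rfl, hu'⟩ := List.cons_eq_cons.1 hu
      obtain ⟨s₁, s₂, c₁, c₂, rfl, rfl, h₁, h₂⟩ := ih hu'
      exact ⟨a :: s₁, s₂, c₁ + p, c₂, rfl, by omega, h₁.mismatch a b, h₂⟩
  | equal a h ih =>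
    rcases t with _ | ⟨b', t⟩
    · obtain rfl : _ = t' := hu
      exact ⟨[], _, 0, _, rfl, (Nat.zero_add _).symm, nil, h.equal a⟩
    · obtain ⟨rfl, hu'⟩ := List.cons_eq_cons.1 hu
      obtain ⟨s₁, s₂, c₁, c₂, rfl, rfl, h₁, h₂⟩ := ih hu'
      exact ⟨a :: s₁, s₂, c₁, c₂, rfl, rfl, h₁.equal a, h₂⟩

/-- If the deleted character had a partner, the partner becomes unaligned, at an extra cost of at
most `1`. -/
theorem exists_le_delete {b : α} {u : List α} (h : Align p s u c) (hu : u = b :: t) :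
    ∃ c' ≤ c + 1, Align p s t c' := by
  induction h with
  | nil => simp at hu
  | left a _ ih =>
    obtain ⟨c', hc, h⟩ := ih hu
    exact ⟨c' + 1, by omega, h.left a⟩
  | right b h =>
    obtain ⟨rfl, rfl⟩ := List.cons_eq_cons.1 hu
    exact ⟨_, by omega, h⟩
  | mismatch a b h =>
    obtain ⟨rfl, rfl⟩ := List.cons_eq_cons.1 hu
    exact ⟨_, by omega, h.left a⟩
  | equal a h =>
    obtain ⟨rfl, rfl⟩ := List.cons_eq_cons.1 hu
    exact ⟨_, le_rfl, h.left a⟩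

theorem exists_le_substitute {a b : α} {u : List α} (h : Align 1 s u c) (hu : u = a :: t) :
    ∃ c' ≤ c + 1, Align 1 s (b :: t) c' := by
  induction h with
  | nil => simp at hu
  | left a _ ih =>
    obtain ⟨c', hc, h⟩ := ih hu
    exact ⟨c' + 1, by omega, h.left a⟩
  | right _ h =>
    obtain ⟨rfl, rfl⟩ := List.cons_eq_cons.1 hu
    exact ⟨_, by omega, h.right b⟩
  | mismatch a _ h =>
    obtain ⟨rfl, rfl⟩ := List.cons_eq_cons.1 hu
    exact ⟨_, by omega, h.mismatch a b⟩
  | equal a h =>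
    obtain ⟨rfl, rfl⟩ := List.cons_eq_cons.1 hu
    exact ⟨_, le_rfl, h.mismatch a b⟩

theorem exists_le_editStep {u : List α} (h : Align 1 s t c) (htu : EditStep t u) :
    ∃ c' ≤ c + 1, Align 1 s u c' := by
  cases htu with
  | insert x y a =>
    obtain ⟨s₁, s₂, c₁, c₂, rfl, rfl, h₁, h₂⟩ := h.exists_of_append_right rfl
    exact ⟨_, le_of_eq (Nat.add_assoc _ _ _).symm, h₁.append (h₂.right a)⟩
  | delete x y a =>
    obtain ⟨s₁, s₂, c₁, c₂, rfl, rfl, h₁, h₂⟩ := h.exists_of_append_right rfl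
    obtain ⟨c', hc, h'⟩ := h₂.exists_le_delete rfl
    exact ⟨_, by omega, h₁.append h'⟩
  | substitute x y a b =>
    obtain ⟨s₁, s₂, c₁, c₂, rfl, rfl, h₁, h₂⟩ := h.exists_of_append_right rfl
    obtain ⟨c', hc, h'⟩ := h₂.exists_le_substitute (b := b) rfl
    exact ⟨_, by omega, h₁.append h'⟩

end Align

/-! ### Edit distance as a least alignment cost -/

/-- Start from the free alignment of `s` with itself; each edit raises the cost by at most `1`. -/
theorem EditsIn.exists_align {α : Type*} {s t : List α} {k : ℕ} (h : EditsIn k s t) :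
    ∃ c ≤ k, Align 1 s t c := by
  induction h with
  | refl => exact ⟨0, le_rfl, .refl 1 _⟩
  | tail _ htu ih =>
    obtain ⟨c, hc, h⟩ := ih
    obtain ⟨c', hc', h'⟩ := h.exists_le_editStep htu
    exact ⟨c', by omega, h'⟩

theorem EditStep.cons {α : Type*} {s t : List α} (a : α) (h : EditStep s t) :
    EditStep (a :: s) (a :: t) := by
  cases h with
  | insert u v b => exact .insert (a :: u) v b
  | delete u v b => exact .delete (a :: u) v b
  | substitute u v b b' => exact .substitute (a :: u) v b b'

theorem EditsIn.cons {α : Type*} {s t : List α} {k : ℕ} (a : α) (h : EditsIn k s t) :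
    EditsIn k (a :: s) (a :: t) := by
  induction h with
  | refl => exact .refl _
  | tail _ h ih => exact ih.tail (h.cons a)

theorem EditsIn.head {α : Type*} {s t u : List α} {k : ℕ} (h : EditStep s t)
    (h' : EditsIn k t u) : EditsIn (k + 1) s u := by
  induction h' with
  | refl => exact .tail (.refl _) h
  | tail _ h' ih => exact (ih h).tail h'

theorem Align.editsIn {α : Type*} {s t : List α} {c : ℕ} (h : Align 1 s t c) :
    EditsIn c s t := by
  induction h with
  | nil => exact .refl _
  | left a _ ih => exact .head (.delete [] _ a) ih
  | right b _ ih => exact ih.tail (.insert [] _ b)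
  | mismatch a b _ ih => exact (ih.cons a).tail (.substitute [] _ a b)
  | equal a _ ih => exact ih.cons a

theorem isLeast_align_ed {α : Type*} (s t : List α) : IsLeast {c | Align 1 s t c} (ed s t) := by
  have hlb : ∀ c, Align 1 s t c → ed s t ≤ c := fun c h => Nat.sInf_le h.editsIn
  have hmem : EditsIn (ed s t) s t := Nat.sInf_mem (exists_editsIn s t)
  obtain ⟨c, hc, h⟩ := hmem.exists_align
  exact ⟨le_antisymm (hlb c h) hc ▸ h, hlb⟩

/-! ### Longest common subsequences as alignments -/

/-- The characters aligned for free form `u`. At mismatch cost `2`, every other character of either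
string accounts for one unit of cost. -/
theorem Align.exists_sublist {α : Type*} {s t : List α} {c : ℕ} (h : Align 2 s t c) :
    ∃ u : List α, u.Sublist s ∧ u.Sublist t ∧ s.length + t.length ≤ 2 * u.length + c := by
  induction h with
  | nil => exact ⟨[], .slnil, .slnil, by simp⟩
  | left a _ ih =>
    obtain ⟨u, hs, ht, hl⟩ := ih
    exact ⟨u, hs.cons a, ht, by simp only [List.length_cons]; omega⟩
  | right b _ ih =>
    obtain ⟨u, hs, ht, hl⟩ := ih
    exact ⟨u, hs, ht.cons b, by simp only [List.length_cons]; omega⟩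
  | mismatch a b _ ih =>
    obtain ⟨u, hs, ht, hl⟩ := ih
    exact ⟨u, hs.cons a, ht.cons b, by simp only [List.length_cons]; omega⟩
  | equal a _ ih =>
    obtain ⟨u, hs, ht, hl⟩ := ih
    exact ⟨a :: u, hs.cons_cons a, ht.cons_cons a, by simp only [List.length_cons]; omega⟩

/-- Only the characters of `u` are aligned, and the others are left unaligned. No mismatch is used,
so `p` is arbitrary. -/
theorem exists_align_of_sublist {α : Type*} (p : ℕ) {u s t : List α} (hs : u.Sublist s)
    (ht : u.Sublist t) : ∃ c, Align p s t c ∧ 2 * u.length + c = s.length + t.length := by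
  induction hs generalizing t with
  | slnil => exact ⟨_, .nil_left p t, by simp⟩
  | cons a _ ih =>
    obtain ⟨c, h, hc⟩ := ih ht
    exact ⟨c + 1, h.left a, by simp only [List.length_cons]; omega⟩
  | cons_cons a _ ih =>
    obtain ⟨t₁, t₂, rfl, ha, ht₂⟩ := List.cons_sublist_iff.1 ht
    obtain ⟨x, y, rfl⟩ := List.append_of_mem ha
    obtain ⟨c, h, hc⟩ := ih ((ht₂.trans (List.sublist_append_right y t₂)))
    refine ⟨_, (show Align p _ ((x ++ a :: y) ++ t₂) (x.length + c) from ?_), ?_⟩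
    · rw [List.append_assoc]
      exact (Align.nil_left p x).append (h.equal a)
    · simp only [List.length_cons, List.length_append] at hc ⊢
      omega

theorem lcs_le_length_left {α : Type*} (s t : List α) : lcs s t ≤ s.length := by
  refine csSup_le ⟨0, [], by simp, by simp, rfl⟩ ?_
  rintro k ⟨u, hs, -, rfl⟩
  exact hs.length_le

theorem isLeast_align_lcs {α : Type*} (s t : List α) :
    ∃ c, IsLeast {c | Align 2 s t c} c ∧ 2 * lcs s t + c = s.length + t.length := by
  obtain ⟨u, hs, ht, hu⟩ : lcs s t ∈ {k : ℕ | ∃ u : List α, u.Sublist s ∧ u.Sublist t ∧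
      u.length = k} := Nat.sSup_mem ⟨0, [], by simp, by simp, rfl⟩ (lcs_bddAbove s t)
  obtain ⟨c, h, hc⟩ := exists_align_of_sublist 2 hs ht
  rw [hu] at hc
  refine ⟨c, ⟨h, fun c' h' => ?_⟩, hc⟩
  obtain ⟨u', hs', ht', hl⟩ := Align.exists_sublist h'
  have : u'.length ≤ lcs s t := le_csSup (lcs_bddAbove s t) ⟨u', hs', ht', rfl⟩
  omega

/-! ## Reachability by repeated squaring -/

/-- `Iter E m x y`: there is a walk of length `m` from `x` to `y` along `E`. -/
inductive Iter {α : Type*} (E : α → α → Prop) : ℕ → α → α → Prop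
  | refl (x : α) : Iter E 0 x x
  | tail {m : ℕ} {x y z : α} : Iter E m x y → E y z → Iter E (m + 1) x z

namespace Iter

variable {α : Type*} {E : α → α → Prop} {m m' : ℕ} {x y z : α}

theorem trans (h : Iter E m x y) (h' : Iter E m' y z) : Iter E (m + m') x z := by
  induction h' with
  | refl => exact h
  | tail _ hE ih => exact (ih h).tail hE

theorem head (h : E x y) (h' : Iter E m y z) : Iter E (m + 1) x z := by
  rw [Nat.add_comm]
  exact ((Iter.refl x).tail h).trans h'

theorem split (h : Iter E (m + m') x z) : ∃ y, Iter E m x y ∧ Iter E m' y z := by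
  induction m' generalizing z with
  | zero => exact ⟨z, h, .refl z⟩
  | succ m' ih =>
    cases h with
    | tail h hE =>
      obtain ⟨y, h₁, h₂⟩ := ih h
      exact ⟨y, h₁, h₂.tail hE⟩

/-- Loops pad a short walk to the exact length `2 ^ H` required by repeated squaring. -/
theorem mono (hE : ∀ x, E x x) (h : Iter E m x y) (hm : m ≤ m') : Iter E m' x y := by
  induction hm with
  | refl => exact h
  | step _ ih => exact ih.tail (hE y)

theorem le {E : ℕ → ℕ → Prop} (hE : ∀ x y, E x y → x ≤ y) {x y : ℕ} (h : Iter E m x y) :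
    x ≤ y := by
  induction h with
  | refl => exact le_rfl
  | tail _ h ih => exact ih.trans (hE _ _ h)

end Iter

/-- Reachability in `2 ^ h` steps, by guessing a middle vertex below `N`. -/
def Savitch (E : ℕ → ℕ → Prop) (N : ℕ) : ℕ → ℕ → ℕ → Prop
  | 0, u, v => E u v
  | h + 1, u, v => ∃ w < N, Savitch E N h u w ∧ Savitch E N h w v

/-- Edges never decrease the code, so every middle vertex is at most `v` and restricting it to `w <
N` loses nothing. -/
theorem savitch_iff_iter {E : ℕ → ℕ → Prop} {N : ℕ} (hE : ∀ x y, E x y → x ≤ y) (h : ℕ)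
    {u v : ℕ} (hv : v < N) : Savitch E N h u v ↔ Iter E (2 ^ h) u v := by
  induction h generalizing u v with
  | zero =>
    refine ⟨fun h => (Iter.refl u).tail h, fun h => ?_⟩
    cases h with
    | tail h hE => cases h; exact hE
  | succ h ih =>
    rw [pow_succ, mul_two]
    constructor
    · rintro ⟨w, hw, h₁, h₂⟩
      exact ((ih hw).1 h₁).trans ((ih hv).1 h₂)
    · intro h'
      obtain ⟨w, h₁, h₂⟩ := h'.split
      have hw : w < N := (h₂.le hE).trans_lt hv
      exact ⟨w, hw, (ih hw).2 h₁, (ih hv).2 h₂⟩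

/-! ## The alignment graph -/

/-- The edges of the alignment graph of `s` and `t`. The triple of a position `i` in `s`, a
position `j` in `t` and a cost `c` is encoded as the number `i * K ^ 2 + j * K + c`. -/
def AlignEdge (p K : ℕ) (s t : List ℕ) (u v : ℕ) : Prop :=
  u = v ∨ u + K * K + 1 = v ∨ u + K + 1 = v ∨ u + K * K + K + p = v ∨
    (u + K * K + K = v ∧ s.getD (u / (K * K)) 0 = t.getD (u / K - u / (K * K) * K) 0)

theorem AlignEdge.le {p K : ℕ} {s t : List ℕ} (u v : ℕ) (h : AlignEdge p K s t u v) :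
    u ≤ v := by
  unfold AlignEdge at h
  generalize K * K = K2 at h
  omega

theorem code_div_sq {K i j c : ℕ} (hj : j < K) (hc : c < K) :
    (i * (K * K) + j * K + c) / (K * K) = i := by
  apply Nat.div_eq_of_lt_le
  · omega
  · nlinarith

theorem code_div {K i j c : ℕ} (hc : c < K) :
    (i * (K * K) + j * K + c) / K = i * K + j := by
  apply Nat.div_eq_of_lt_le
  · nlinarith
  · nlinarith

theorem code_inj {K i j c i' j' c' : ℕ} (hj : j < K) (hc : c < K) (hj' : j' < K) (hc' : c' < K)
    (h : i * (K * K) + j * K + c = i' * (K * K) + j' * K + c') : i = i' ∧ j = j' ∧ c = c' := by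
  have hi := congrArg (· / (K * K)) h
  simp only [code_div_sq hj hc, code_div_sq hj' hc'] at hi
  have hd := congrArg (· / K) h
  simp only [code_div hc, code_div hc', hi] at hd
  subst hi
  obtain rfl : j = j' := by omega
  exact ⟨rfl, rfl, by omega⟩

theorem alignEdge_code_equal {p K i j c : ℕ} {s t : List ℕ} (hj : j < K) (hc : c < K)
    (h : s.getD i 0 = t.getD j 0) :
    AlignEdge p K s t (i * (K * K) + j * K + c) ((i + 1) * (K * K) + (j + 1) * K + c) := by
  refine .inr (.inr (.inr (.inr ⟨by ring, ?_⟩)))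
  rwa [code_div_sq hj hc, code_div hc, Nat.add_sub_cancel_left]

/-- The prefixes `s₀`, `t₀` already aligned and their cost `c₀` are carried along, so that the graph
of the full strings stays fixed during the induction. -/
theorem Align.iter {p K c : ℕ} {a b : List ℕ} (h : Align p a b c) (s₀ t₀ : List ℕ) (c₀ : ℕ)
    (hj : t₀.length + b.length < K) (hc : c₀ + c < K) :
    ∃ m ≤ a.length + b.length, Iter (AlignEdge p K (s₀ ++ a) (t₀ ++ b)) m
      (s₀.length * (K * K) + t₀.length * K + c₀)
      ((s₀.length + a.length) * (K * K) + (t₀.length + b.length) * K + (c₀ + c)) := by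
  induction h generalizing s₀ t₀ c₀ with
  | nil => exact ⟨0, le_rfl, .refl _⟩
  | @left a b c x _ ih =>
    obtain ⟨m, hm, h⟩ := ih (s₀ ++ [x]) t₀ (c₀ + 1) hj (by omega)
    refine ⟨m + 1, by simp only [List.length_cons]; omega, .head (y := ?_) ?_ ?_⟩
    rotate_left 2
    · convert h using 1
      · simp
      · simp only [List.length_append, List.length_cons, List.length_nil]; ring
    · refine .inr (.inl ?_)
      simp only [List.length_append, List.length_cons, List.length_nil]; ring
  | @right a b c x _ ih =>
    simp only [List.length_cons] at hj
    obtain ⟨m, hm, h⟩ := ih s₀ (t₀ ++ [x]) (c₀ + 1) (by simp; omega) (by omega)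
    refine ⟨m + 1, by simp only [List.length_cons]; omega, .head (y := ?_) ?_ ?_⟩
    rotate_left 2
    · convert h using 1
      · simp
      · simp only [List.length_append, List.length_cons, List.length_nil]; ring
    · refine .inr (.inr (.inl ?_))
      simp only [List.length_append, List.length_cons, List.length_nil]; ring
  | @mismatch a b c x y _ ih =>
    simp only [List.length_cons] at hj
    obtain ⟨m, hm, h⟩ := ih (s₀ ++ [x]) (t₀ ++ [y]) (c₀ + p) (by simp; omega) (by omega)
    refine ⟨m + 1, by simp only [List.length_cons]; omega, .head (y := ?_) ?_ ?_⟩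
    rotate_left 2
    · convert h using 1
      · simp
      · simp only [List.length_append, List.length_cons, List.length_nil]; ring
    · refine .inr (.inr (.inr (.inl ?_)))
      simp only [List.length_append, List.length_cons, List.length_nil]; ring
  | @equal a b c x _ ih =>
    simp only [List.length_cons] at hj
    obtain ⟨m, hm, h⟩ := ih (s₀ ++ [x]) (t₀ ++ [x]) c₀ (by simp; omega) (by omega)
    refine ⟨m + 1, by simp only [List.length_cons]; omega, .head (y := ?_) ?_ ?_⟩
    rotate_left 2
    · convert h using 1
      · simp
      · simp only [List.length_append, List.length_cons, List.length_nil]; ring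
    · have := alignEdge_code_equal (p := p) (K := K) (i := s₀.length) (j := t₀.length) (c := c₀)
        (s := s₀ ++ x :: a) (t := t₀ ++ x :: b) (by omega) (by omega) (by simp)
      simpa using this

theorem Align.snoc_left {α : Type*} {p c : ℕ} {s t : List α} (h : Align p s t c) (a : α) :
    Align p (s ++ [a]) t (c + 1) := by
  simpa using h.append (Align.nil.left a)

theorem Align.snoc_right {α : Type*} {p c : ℕ} {s t : List α} (h : Align p s t c) (b : α) :
    Align p s (t ++ [b]) (c + 1) := by
  simpa using h.append (Align.nil.right b)

theorem Align.snoc_mismatch {α : Type*} {p c : ℕ} {s t : List α} (h : Align p s t c) (a b : α) :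
    Align p (s ++ [a]) (t ++ [b]) (c + p) := by
  simpa using h.append (Align.nil.mismatch a b)

theorem Align.snoc_equal {α : Type*} {p c : ℕ} {s t : List α} (h : Align p s t c) (a : α) :
    Align p (s ++ [a]) (t ++ [a]) c := h.append (Align.nil.equal a)

/-- In `m` steps `j` grows by at most `m` and `c` by at most `2 * m < K`, so no digit overflows. A
walk may leave the grid, where the default `0` of `getD` creates spurious equalities. Since `i` and
`j` never decrease, such a walk cannot return, which is why the alignment is claimed only inside the
grid. -/
theorem Iter.exists_align {p K m v : ℕ} {s t : List ℕ} (hp : p ≤ 2)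
    (h : Iter (AlignEdge p K s t) m 0 v) (hK : 2 * m < K) :
    ∃ i j c, v = i * (K * K) + j * K + c ∧ j ≤ m ∧ c ≤ 2 * m ∧
      (i ≤ s.length → j ≤ t.length → Align p (s.take i) (t.take j) c) := by
  generalize hx : 0 = x at h
  induction h with
  | refl =>
    subst hx
    exact ⟨0, 0, 0, by simp, le_rfl, le_rfl, fun _ _ => by simpa using Align.nil⟩
  | @tail m x y z _ hE ih =>
    obtain ⟨i, j, c, rfl, hj, hc, hal⟩ := ih (by omega) hx
    rcases hE with rfl | rfl | rfl | rfl | ⟨rfl, heq⟩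
    · exact ⟨i, j, c, rfl, by omega, by omega, hal⟩
    · refine ⟨i + 1, j, c + 1, by ring, by omega, by omega, fun hi hj' => ?_⟩
      rw [← List.take_concat_get' s i (by omega)]
      exact (hal (by omega) hj').snoc_left _
    · refine ⟨i, j + 1, c + 1, by ring, by omega, by omega, fun hi hj' => ?_⟩
      rw [← List.take_concat_get' t j (by omega)]
      exact (hal hi (by omega)).snoc_right _
    · refine ⟨i + 1, j + 1, c + p, by ring, by omega, by omega, fun hi hj' => ?_⟩
      rw [← List.take_concat_get' t j (by omega), ← List.take_concat_get' s i (by omega)]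
      exact (hal (by omega) (by omega)).snoc_mismatch _ _
    · refine ⟨i + 1, j + 1, c, by ring, by omega, by omega, fun hi hj' => ?_⟩
      rw [code_div_sq (by omega) (by omega), code_div (by omega), Nat.add_sub_cancel_left,
        List.getD_eq_getElem _ _ (by omega), List.getD_eq_getElem _ _ (by omega)] at heq
      rw [← List.take_concat_get' t j (by omega), ← List.take_concat_get' s i (by omega), heq]
      exact (hal (by omega) (by omega)).snoc_equal _

theorem savitch_alignEdge_iff {p K N H n c : ℕ} {s t : List ℕ} (hp : p ≤ 2) (hs : s.length = n)
    (ht : t.length = n) (hH : 2 * n ≤ 2 ^ H) (hK : 2 * 2 ^ H < K) (hc : c < K)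
    (hN : n * (K * K + K) + c < N) :
    Savitch (AlignEdge p K s t) N H 0 (n * (K * K + K) + c) ↔ Align p s t c := by
  rw [savitch_iff_iter AlignEdge.le H hN]
  constructor
  · intro h
    obtain ⟨i, j, c', hv, hj, hc', hal⟩ := h.exists_align hp hK
    rw [Nat.mul_add] at hv
    obtain ⟨rfl, rfl, rfl⟩ := code_inj (by omega) hc (by omega) (by omega) hv
    have h := hal hs.ge ht.ge
    rwa [List.take_of_length_le hs.le, List.take_of_length_le ht.le] at h
  · intro h
    obtain ⟨m, hm, h⟩ := h.iter (K := K) [] [] 0 (by simp; omega) (by omega)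
    have := h.mono (m' := 2 ^ H) (fun x => .inl rfl) (by omega)
    simpa [hs, ht, Nat.mul_add] using this

/-! ## Total correctness of machines within a bound on the register contents -/

/-- From control state `q` and register contents `σ`, the program `prog` stops with result `v`, and
the contents of the registers stay below `X` if they are below `X` to begin with. -/
inductive Computes {Q R : Type} [DecidableEq R] (prog : Q → Instr Q R) (out : R)
    (s t : List ℕ) (X v : ℕ) : Q → (R → ℕ) → Prop
  | halt {q σ} : prog q = .halt → σ out = v → Computes prog out s t X v q σ
  | const {q q' dst σ} (x : ℕ) : prog q = .const dst x q' → x < X →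
      Computes prog out s t X v q' (Function.update σ dst x) → Computes prog out s t X v q σ
  | copy {q q' dst a σ} (x : ℕ) : prog q = .copy dst a q' → σ a = x → x < X →
      Computes prog out s t X v q' (Function.update σ dst x) → Computes prog out s t X v q σ
  | add {q q' dst a b σ} (x : ℕ) : prog q = .add dst a b q' → σ a + σ b = x → x < X →
      Computes prog out s t X v q' (Function.update σ dst x) → Computes prog out s t X v q σ
  | sub {q q' dst a b σ} (x : ℕ) : prog q = .sub dst a b q' → σ a - σ b = x → x < X →
      Computes prog out s t X v q' (Function.update σ dst x) → Computes prog out s t X v q σ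
  | mul {q q' dst a b σ} (x : ℕ) : prog q = .mul dst a b q' → σ a * σ b = x → x < X →
      Computes prog out s t X v q' (Function.update σ dst x) → Computes prog out s t X v q σ
  | div {q q' dst a b σ} (x : ℕ) : prog q = .div dst a b q' → σ a / σ b = x → x < X →
      Computes prog out s t X v q' (Function.update σ dst x) → Computes prog out s t X v q σ
  | readFst {q q' dst a σ} (x : ℕ) : prog q = .readFst dst a q' → s.getD (σ a) 0 = x → x < X →
      Computes prog out s t X v q' (Function.update σ dst x) → Computes prog out s t X v q σ
  | readSnd {q q' dst a σ} (x : ℕ) : prog q = .readSnd dst a q' → t.getD (σ a) 0 = x → x < X →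
      Computes prog out s t X v q' (Function.update σ dst x) → Computes prog out s t X v q σ
  | branchLe {q q' q'' a b σ} : prog q = .branchLe a b q' q'' →
      Computes prog out s t X v (if σ a ≤ σ b then q' else q'') σ → Computes prog out s t X v q σ

namespace Computes

section

variable {Q R : Type} [DecidableEq R] {prog : Q → Instr Q R} {out : R} {s t : List ℕ} {X v : ℕ}
  {σ : R → ℕ} {q q' q'' : Q} {a b : R}

theorem branch (hq : prog q = .branchLe a b q' q'')
    (h : σ a ≤ σ b → Computes prog out s t X v q' σ)
    (h' : σ b < σ a → Computes prog out s t X v q'' σ) : Computes prog out s t X v q σ := by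
  refine .branchLe hq ?_
  split_ifs with hab
  · exact h hab
  · exact h' (not_le.1 hab)

theorem branchEq {q₁ : Q} (hq : prog q = .branchLe a b q₁ q'')
    (hq₁ : prog q₁ = .branchLe b a q' q'') (h : σ a = σ b → Computes prog out s t X v q' σ)
    (h' : σ a ≠ σ b → Computes prog out s t X v q'' σ) : Computes prog out s t X v q σ :=
  branch hq (fun h₁ => branch hq₁ (fun h₂ => h (le_antisymm h₁ h₂)) fun h₂ => h' h₂.ne)
    fun h₁ => h' h₁.ne'

end

variable {M : Machine} {s t : List ℕ} {X v : ℕ}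

theorem exists_and_forall {q : M.Q} {σ : M.R → ℕ} (h : Computes M.prog M.out s t X v q σ)
    (hσ : ∀ r, σ r < X) :
    (∃ c', Relation.ReflTransGen (fun a b => M.step s t a = some b) ⟨q, σ⟩ c' ∧
      M.step s t c' = none ∧ c'.regs M.out = v) ∧
    ∀ c', Relation.ReflTransGen (fun a b => M.step s t a = some b) ⟨q, σ⟩ c' →
      ∀ r, c'.regs r < X := by
  -- By determinism, a configuration reached from `c` is `c` itself or is reached from its only
  -- successor `d`.
  have key : ∀ {c d : M.Config}, M.step s t c = some d → (∀ r, c.regs r < X) →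
      ((∃ c', Relation.ReflTransGen (fun a b => M.step s t a = some b) d c' ∧
        M.step s t c' = none ∧ c'.regs M.out = v) ∧
      ∀ c', Relation.ReflTransGen (fun a b => M.step s t a = some b) d c' →
        ∀ r, c'.regs r < X) →
      ((∃ c', Relation.ReflTransGen (fun a b => M.step s t a = some b) c c' ∧
        M.step s t c' = none ∧ c'.regs M.out = v) ∧
      ∀ c', Relation.ReflTransGen (fun a b => M.step s t a = some b) c c' →
        ∀ r, c'.regs r < X) := by
    rintro c d hs hc ⟨⟨c', h₁, h₂⟩, h₃⟩
    refine ⟨⟨c', .head hs h₁, h₂⟩, fun c' h => ?_⟩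
    rcases h.cases_head with rfl | ⟨d', hd, h⟩
    · exact hc
    · obtain rfl : d = d' := Option.some_injective _ (hs.symm.trans hd)
      exact h₃ c' h
  have hupd : ∀ {σ : M.R → ℕ} {x : ℕ} (dst : M.R), (∀ r, σ r < X) → x < X →
      ∀ r, Function.update σ dst x r < X := fun dst hσ hx r => by
    simp only [Function.update_apply]
    split_ifs
    · exact hx
    · exact hσ r
  induction h with
  | @halt q σ hq hv =>
    have hs : M.step s t ⟨q, σ⟩ = none := by simp [Machine.step, hq]
    refine ⟨⟨_, .refl, hs, hv⟩, fun c' h => ?_⟩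
    rcases h.cases_head with rfl | ⟨d, hd, -⟩
    · exact hσ
    · simp [hs] at hd
  | const x hq hx _ ih =>
    exact key (by simp [Machine.step, hq, Machine.Config.put]) hσ (ih (hupd _ hσ hx))
  | copy x hq h hx _ ih | add x hq h hx _ ih | sub x hq h hx _ ih | mul x hq h hx _ ih
  | div x hq h hx _ ih | readFst x hq h hx _ ih | readSnd x hq h hx _ ih =>
    exact key (by simp only [Machine.step, hq, Machine.Config.put, h]) hσ (ih (hupd _ hσ hx))
  | branchLe hq _ ih => exact key (by simp [Machine.step, hq]) hσ (ih hσ)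

theorem computesWithin
    (h : Computes M.prog M.out s t X v M.start (Function.update (fun _ => 0) M.inp s.length))
    (hX : s.length < X) : M.ComputesWithin s t v (Fintype.card M.R * Nat.size X) := by
  obtain ⟨h₁, h₂⟩ := h.exists_and_forall fun r => by
    simp only [Function.update_apply]
    split_ifs <;> omega
  refine ⟨h₁, fun c hc => ?_⟩
  calc c.memory ≤ ∑ _r : M.R, Nat.size X :=
        Finset.sum_le_sum fun r _ => Nat.size_le_size (h₂ c hc r).le
    _ = Fintype.card M.R * Nat.size X := by simp

end Computes

/-! ## The machine -/

/-- The registers of `alignMachine`. -/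
inductive Reg : Type
  | inp | out | one | zero | p | P | H | K | K2 | N | T | h | u | v | w | S | a | b | d | e
  deriving DecidableEq

instance : Fintype Reg where
  elems := {.inp, .out, .one, .zero, .p, .P, .H, .K, .K2, .N, .T, .h, .u, .v, .w, .S, .a, .b, .d, .e}
  complete x := by cases x <;> simp

/-- The program of `alignMachine`. The entry points are `4` (computation of the parameters), `13`
(search for the cost), `17` (call of the reachability test), `19` (next middle vertex), `28` (test
of an edge), `54` (return of a negative answer), `69` (return of a positive answer). -/
def alignProgram (p : ℕ) (last : Instr (Fin 92) Reg) : List (Instr (Fin 92) Reg) :=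
  [.const .one 1 1, .const .p p 2, .const .P 1 3, .add .a .inp .inp 4,
    .branchLe .P .a 5 7, .add .P .P .P 6, .add .H .H .one 4,
    .add .K .P .P 8, .add .K .K .P 9, .mul .K2 .K .K 10, .mul .N .K2 .K 11,
    .add .a .K2 .K 12, .mul .T .inp .a 13,
    .copy .h .H 14, .const .u 0 15, .copy .v .T 16, .const .S 0 17,
    .branchLe .h .zero 28 18, .const .w 0 19,
    .mul .S .S .N 20, .add .S .S .u 21, .mul .S .S .N 22, .add .S .S .v 23,
    .mul .S .S .N 24, .add .S .S .w 25, .mul .S .S .N 26, .copy .v .w 27, .sub .h .h .one 17,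
    .copy .a .u 29, .branchLe .a .v 30 31, .branchLe .v .a 69 31,
    .add .a .u .K2 32, .add .a .a .one 33, .branchLe .a .v 34 35, .branchLe .v .a 69 35,
    .add .a .u .K 36, .add .a .a .one 37, .branchLe .a .v 38 39, .branchLe .v .a 69 39,
    .add .a .u .K2 40, .add .a .a .K 41, .add .b .a .p 42,
    .branchLe .b .v 43 44, .branchLe .v .b 69 44, .branchLe .a .v 45 54, .branchLe .v .a 46 54,
    .div .a .u .K2 47, .readFst .d .a 48, .div .b .u .K 49, .mul .a .a .K 50, .sub .a .b .a 51,
    .readSnd .e .a 52, .branchLe .d .e 53 54, .branchLe .e .d 69 54,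
    .branchLe .H .h 85 55, .div .S .S .N 56,
    .div .a .S .N 57, .mul .b .a .N 58, .sub .w .S .b 59,
    .div .S .a .N 60, .mul .b .S .N 61, .sub .v .a .b 62,
    .div .a .S .N 63, .mul .b .a .N 64, .sub .u .S .b 65,
    .copy .S .a 66, .add .h .h .one 67, .add .w .w .one 68, .branchLe .N .w 54 19,
    .branchLe .H .h 86 70, .div .a .S .N 71, .mul .b .a .N 72, .sub .d .S .b 73,
    .branchLe .one .d 74 78,
    .div .S .a .N 75, .div .S .S .N 76, .div .S .S .N 77, .add .h .h .one 69,
    .add .S .S .one 79, .div .b .a .N 80, .mul .d .b .N 81, .sub .u .a .d 82,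
    .div .d .b .N 83, .mul .d .d .N 84, .sub .v .b .d 17,
    .add .T .T .one 13,
    .add .a .K2 .K 87, .mul .a .inp .a 88, .sub .out .T .a 89, .div .out .out .p 90, last, .halt]

/-- The machine that finds the least cost `c` of an alignment of two strings with mismatch cost `p`,
computes `c / p` and finishes with the instruction `last`. -/
def alignMachine (p : ℕ) (last : Instr (Fin 92) Reg) : Machine where
  Q := Fin 92
  R := Reg
  start := 0
  inp := .inp
  out := .out
  prog q := (alignProgram p last).getD q.val .halt

namespace alignMachine

/-- `Computes` for the machine `alignMachine p last`. -/
abbrev AlignComputes (p : ℕ) (last : Instr (Fin 92) Reg) (s t : List ℕ) (X v : ℕ) (q : Fin 92)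
    (σ : Reg → ℕ) : Prop :=
  Computes (fun q : Fin 92 => (alignProgram p last).getD q.val .halt) Reg.out s t X v q σ

/-- The contents of the registers that are constant during the reachability test. -/
structure Params (n p H K N T : ℕ) (σ : Reg → ℕ) : Prop where
  inp_eq : σ .inp = n
  one_eq : σ .one = 1
  zero_eq : σ .zero = 0
  p_eq : σ .p = p
  H_eq : σ .H = H
  K_eq : σ .K = K
  K2_eq : σ .K2 = K * K
  N_eq : σ .N = N
  T_eq : σ .T = T

/-- The bound `X` on the register contents suffices for the parameters. -/
structure Large (X n p H K N : ℕ) (s t : List ℕ) : Prop where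
  two_le : 2 ≤ N
  edge : N + K * K + K + p + 1 < X
  depth : H < X
  fst : ∀ i, s.getD i 0 < X
  snd : ∀ i, t.getD i 0 < X

/-! ### Edge test and stack operations -/

variable {n p H K N T X r : ℕ} {s t : List ℕ} {last : Instr (Fin 92) Reg}

theorem computes_edge {σ : Reg → ℕ} {u v S : ℕ} (hσ : Params n p H K N T σ)
    (hX : Large X n p H K N s t) (hh : σ .h = 0) (hu : σ .u = u) (hv : σ .v = v) (hS : σ .S = S)
    (huN : u < N)
    (hyes : ∀ σ', Params n p H K N T σ' → σ' .h = 0 → σ' .S = S → AlignEdge p K s t u v →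
      AlignComputes p last s t X r 69 σ')
    (hno : ∀ σ', Params n p H K N T σ' → σ' .h = 0 → σ' .S = S → ¬ AlignEdge p K s t u v →
      AlignComputes p last s t X r 54 σ') :
    AlignComputes p last s t X r 28 σ := by
  obtain ⟨h₁, h₂, h₃, h₄, h₅, h₆, h₇, h₈, h₉⟩ := hσ
  have hle := hX.edge
  refine .copy u rfl hu (by omega) ?_
  refine .branchEq (q' := (69 : Fin 92)) (q'' := (31 : Fin 92)) rfl rfl (fun h => ?_) fun e₁ => ?_
  · refine hyes _ (by constructor <;> simp [*]) (by simp [*]) (by simp [*]) (.inl ?_)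
    simpa [hv] using h
  refine .add (u + K * K) rfl (by simp [*]) (by omega) ?_
  refine .add (u + K * K + 1) rfl (by simp [*]) (by omega) ?_
  refine .branchEq (q' := (69 : Fin 92)) (q'' := (35 : Fin 92)) rfl rfl (fun h => ?_) fun e₂ => ?_
  · refine hyes _ (by constructor <;> simp [*]) (by simp [*]) (by simp [*]) (.inr (.inl ?_))
    simpa [hv] using h
  refine .add (u + K) rfl (by simp [*]) (by omega) ?_
  refine .add (u + K + 1) rfl (by simp [*]) (by omega) ?_
  refine .branchEq (q' := (69 : Fin 92)) (q'' := (39 : Fin 92)) rfl rfl (fun h => ?_) fun e₃ => ?_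
  · refine hyes _ (by constructor <;> simp [*]) (by simp [*]) (by simp [*]) (.inr (.inr (.inl ?_)))
    simpa [hv] using h
  refine .add (u + K * K) rfl (by simp [*]) (by omega) ?_
  refine .add (u + K * K + K) rfl (by simp [*]) (by omega) ?_
  refine .add (u + K * K + K + p) rfl (by simp [*]) (by omega) ?_
  refine .branchEq (q' := (69 : Fin 92)) (q'' := (44 : Fin 92)) rfl rfl (fun h => ?_) fun e₄ => ?_
  · refine hyes _ (by constructor <;> simp [*]) (by simp [*]) (by simp [*])
      (.inr (.inr (.inr (.inl ?_))))
    simpa [hv] using h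
  simp only [ne_eq, Function.update_self, Function.update_of_ne, reduceCtorEq, not_false_eq_true,
    hv] at e₁ e₂ e₃ e₄
  -- Register `a` still holds `u + K * K + K`, the target of a free step; only if it equals `v` are
  -- the characters queried.
  refine .branchEq (q' := (46 : Fin 92)) (q'' := (54 : Fin 92)) rfl rfl (fun e₅ => ?_) fun e₅ => ?_
  swap
  · refine hno _ (by constructor <;> simp [*]) (by simp [*]) (by simp [*]) ?_
    simp only [ne_eq, Function.update_self, Function.update_of_ne, reduceCtorEq,
      not_false_eq_true, hv] at e₅
    simp [AlignEdge, *]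
  simp only [ne_eq, Function.update_self, Function.update_of_ne, reduceCtorEq,
      not_false_eq_true, hv] at e₅
  have hi : u / (K * K) ≤ u := Nat.div_le_self _ _
  have hj : u / K ≤ u := Nat.div_le_self _ _
  have hm : u / (K * K) * K ≤ u := by
    rw [← Nat.div_div_eq_div_mul]
    exact (Nat.div_mul_le_self _ _).trans hj
  refine .div (u / (K * K)) rfl (by simp [*]) (by omega) ?_
  refine .readFst (s.getD (u / (K * K)) 0) rfl (by simp) (hX.fst _) ?_
  refine .div (u / K) rfl (by simp [*]) (by omega) ?_
  refine .mul (u / (K * K) * K) rfl (by simp [*]) (by omega) ?_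
  refine .sub (u / K - u / (K * K) * K) rfl (by simp [*]) (by omega) ?_
  refine .readSnd (t.getD (u / K - u / (K * K) * K) 0) rfl (by simp) (hX.snd _) ?_
  refine .branchEq (q' := (69 : Fin 92)) (q'' := (54 : Fin 92)) rfl rfl (fun e₆ => ?_) fun e₆ => ?_
  · refine hyes _ (by constructor <;> simp [*]) (by simp [*]) (by simp [*])
      (.inr (.inr (.inr (.inr ⟨e₅, ?_⟩))))
    simpa using e₆
  · refine hno _ (by constructor <;> simp [*]) (by simp [*]) (by simp [*]) ?_
    rintro (h | h | h | h | h)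
    · exact e₁ h
    · exact e₂ h
    · exact e₃ h
    · exact e₄ h
    · exact e₆ (by simpa using h.2)

theorem push_div {N x S : ℕ} (hx : x < N) : (S * N + x) / N = S :=
  Nat.div_eq_of_lt_le (by omega) (by rw [Nat.succ_mul]; omega)

/-- The stack `S` with a new frame on top, in base `N`. -/
def frame (N S u v w : ℕ) : ℕ := ((S * N + u) * N + v) * N + w

/-- A pushed level costs four base-`N` digits: `u`, `v`, `w` and the flag. The summand `N` leaves
room for any flag digit. -/
theorem frame_lt {S u v w : ℕ} (hu : u < N) (hv : v < N) (hw : w < N) :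
    frame N S u v w * N + N ≤ (S + 1) * N ^ 4 := by
  have h₁ : S * N + u + 1 ≤ (S + 1) * N := by rw [Nat.succ_mul]; omega
  have h₂ : (S * N + u) * N + v + 1 ≤ (S + 1) * N * N := by
    refine le_trans ?_ (Nat.mul_le_mul_right N h₁)
    rw [Nat.succ_mul]; omega
  have h₃ : frame N S u v w + 1 ≤ (S + 1) * N * N * N := by
    refine le_trans ?_ (Nat.mul_le_mul_right N h₂)
    rw [Nat.succ_mul, frame]; omega
  calc frame N S u v w * N + N = (frame N S u v w + 1) * N := by ring
    _ ≤ (S + 1) * N * N * N * N := Nat.mul_le_mul_right N h₃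
    _ = (S + 1) * N ^ 4 := by ring

/-- After a negative answer, the next middle vertex is tried. -/
theorem computes_fail {σ : Reg → ℕ} {h u v w S x : ℕ} (hσ : Params n p H K N T σ)
    (hX : Large X n p H K N s t) (hh : σ .h = h) (hH : h < H) (hx : x < N)
    (hS : σ .S = frame N S u v w * N + x) (hu : u < N) (hv : v < N) (hw : w < N)
    (hSX : frame N S u v w < X)
    (hnext : ∀ σ', Params n p H K N T σ' → σ' .h = h + 1 → σ' .S = S → σ' .u = u → σ' .v = v →
      σ' .w = w + 1 → w + 1 < N → AlignComputes p last s t X r 19 σ')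
    (hno : ∀ σ', Params n p H K N T σ' → σ' .h = h + 1 → σ' .S = S → w + 1 = N →
      AlignComputes p last s t X r 54 σ') :
    AlignComputes p last s t X r 54 σ := by
  obtain ⟨h₁, h₂, h₃, h₄, h₅, h₆, h₇, h₈, h₉⟩ := hσ
  have hle := hX.edge
  have hdep := hX.depth
  have hf : frame N S u v w = ((S * N + u) * N + v) * N + w := rfl
  have c₁ := Nat.le_mul_of_pos_right (S * N + u) (show 0 < N by omega)
  have c₂ := Nat.le_mul_of_pos_right ((S * N + u) * N + v) (show 0 < N by omega)
  have c₃ := Nat.le_mul_of_pos_right S (show 0 < N by omega)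
  refine .branch (q' := (85 : Fin 92)) (q'' := (55 : Fin 92)) rfl (fun hHh => ?_) fun _ => ?_
  · simp only [h₅, hh] at hHh
    omega
  refine .div (frame N S u v w) rfl (by simp only [hS, h₈, push_div hx]) hSX ?_
  refine .div ((S * N + u) * N + v) rfl (by simp [h₈, hf, push_div hw]) (by omega) ?_
  refine .mul (((S * N + u) * N + v) * N) rfl (by simp [h₈]) (by omega) ?_
  refine .sub w rfl (by simp [hf]) (by omega) ?_
  refine .div (S * N + u) rfl (by simp [h₈, push_div hv]) (by omega) ?_
  refine .mul ((S * N + u) * N) rfl (by simp [h₈]) (by omega) ?_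
  refine .sub v rfl (by simp) (by omega) ?_
  refine .div S rfl (by simp [h₈, push_div hu]) (by omega) ?_
  refine .mul (S * N) rfl (by simp [h₈]) (by omega) ?_
  refine .sub u rfl (by simp) (by omega) ?_
  refine .copy S rfl (by simp) (by omega) ?_
  refine .add (h + 1) rfl (by simp [*]) (by omega) ?_
  refine .add (w + 1) rfl (by simp [*]) (by omega) ?_
  refine .branch (q' := (54 : Fin 92)) (q'' := (19 : Fin 92)) rfl (fun hw' => ?_) fun hw' => ?_
  · refine hno _ (by constructor <;> simp [*]) (by simp) (by simp) ?_
    simp [h₈] at hw'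
    omega
  · exact hnext _ (by constructor <;> simp [*]) (by simp) (by simp) (by simp) (by simp) (by simp)
      (by simpa [h₈] using hw')

/-- After a positive answer for the first half, the second half is tested. -/
theorem computes_half {σ : Reg → ℕ} {h u v w S : ℕ} (hσ : Params n p H K N T σ)
    (hX : Large X n p H K N s t) (hh : σ .h = h) (hH : h < H)
    (hS : σ .S = frame N S u v w * N) (hv : v < N) (hw : w < N)
    (hSX : frame N S u v w * N + 1 < X)
    (hnext : ∀ σ', Params n p H K N T σ' → σ' .h = h → σ' .S = frame N S u v w * N + 1 →
      σ' .u = w → σ' .v = v → AlignComputes p last s t X r 17 σ') :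
    AlignComputes p last s t X r 69 σ := by
  obtain ⟨h₁, h₂, h₃, h₄, h₅, h₆, h₇, h₈, h₉⟩ := hσ
  have hle := hX.edge
  have hf : frame N S u v w = ((S * N + u) * N + v) * N + w := rfl
  have hN : 0 < N := by omega
  have c₁ := Nat.le_mul_of_pos_right (S * N + u) hN
  have c₂ := Nat.le_mul_of_pos_right ((S * N + u) * N + v) hN
  have c₃ := Nat.le_mul_of_pos_right (frame N S u v w) hN
  refine .branch (q' := (86 : Fin 92)) (q'' := (70 : Fin 92)) rfl (fun hHh => ?_) fun _ => ?_
  · simp only [h₅, hh] at hHh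
    omega
  refine .div (frame N S u v w) rfl (by simp only [hS, h₈, Nat.mul_div_cancel _ hN]) (by omega) ?_
  refine .mul (frame N S u v w * N) rfl (by simp [h₈]) (by omega) ?_
  -- The last digit `0` says that the first half was under test; `1` would mean the second.
  refine .sub 0 rfl (by simp [hS]) (by omega) ?_
  refine .branch (q' := (74 : Fin 92)) (q'' := (78 : Fin 92)) rfl (fun h => ?_) fun _ => ?_
  · simp [h₂] at h
  refine .add (frame N S u v w * N + 1) rfl (by simp [*]) hSX ?_
  refine .div ((S * N + u) * N + v) rfl (by simp [h₈, hf, push_div hw]) (by omega) ?_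
  refine .mul (((S * N + u) * N + v) * N) rfl (by simp [h₈]) (by omega) ?_
  refine .sub w rfl (by simp [hf]) (by omega) ?_
  refine .div (S * N + u) rfl (by simp [h₈, push_div hv]) (by omega) ?_
  refine .mul ((S * N + u) * N) rfl (by simp [h₈]) (by omega) ?_
  refine .sub v rfl (by simp) (by omega) ?_
  exact hnext _ (by constructor <;> simp [*]) (by simp [*]) (by simp) (by simp) (by simp)

/-- After a positive answer for both halves, a positive answer is returned. -/
theorem computes_done {σ : Reg → ℕ} {h u v w S : ℕ} (hσ : Params n p H K N T σ)
    (hX : Large X n p H K N s t) (hh : σ .h = h) (hH : h < H)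
    (hS : σ .S = frame N S u v w * N + 1) (hu : u < N) (hv : v < N) (hw : w < N)
    (hSX : frame N S u v w * N + 1 < X)
    (hnext : ∀ σ', Params n p H K N T σ' → σ' .h = h + 1 → σ' .S = S →
      AlignComputes p last s t X r 69 σ') :
    AlignComputes p last s t X r 69 σ := by
  obtain ⟨h₁, h₂, h₃, h₄, h₅, h₆, h₇, h₈, h₉⟩ := hσ
  have hle := hX.edge
  have hdep := hX.depth
  have h2N := hX.two_le
  have hf : frame N S u v w = ((S * N + u) * N + v) * N + w := rfl
  have hN : 0 < N := by omega
  have c₀ := Nat.le_mul_of_pos_right S hN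
  have c₁ := Nat.le_mul_of_pos_right (S * N + u) hN
  have c₂ := Nat.le_mul_of_pos_right ((S * N + u) * N + v) hN
  have c₃ := Nat.le_mul_of_pos_right (frame N S u v w) hN
  refine .branch (q' := (86 : Fin 92)) (q'' := (70 : Fin 92)) rfl (fun hHh => ?_) fun _ => ?_
  · simp only [h₅, hh] at hHh
    omega
  refine .div (frame N S u v w) rfl (by simp only [hS, h₈, push_div h2N]) (by omega) ?_
  refine .mul (frame N S u v w * N) rfl (by simp [h₈]) (by omega) ?_
  refine .sub 1 rfl (by simp [hS]) (by omega) ?_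
  refine .branch (q' := (74 : Fin 92)) (q'' := (78 : Fin 92)) rfl (fun _ => ?_) fun h => ?_
  swap
  · simp [h₂] at h
  refine .div ((S * N + u) * N + v) rfl (by simp [h₈, hf, push_div hw]) (by omega) ?_
  refine .div (S * N + u) rfl (by simp [h₈, push_div hv]) (by omega) ?_
  refine .div S rfl (by simp [h₈, push_div hu]) (by omega) ?_
  refine .add (h + 1) rfl (by simp [*]) (by omega) ?_
  exact hnext _ (by constructor <;> simp [*]) (by simp) (by simp)

/-- A middle vertex is put on the stack. -/
theorem computes_push {σ : Reg → ℕ} {h u v w S : ℕ} (hσ : Params n p H K N T σ)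
    (hX : Large X n p H K N s t) (hh : σ .h = h + 1) (hH : h < H) (hS : σ .S = S)
    (hu : σ .u = u) (hv : σ .v = v) (hw : σ .w = w) (hwN : w < N)
    (hSX : frame N S u v w * N + 1 < X)
    (hnext : ∀ σ', Params n p H K N T σ' → σ' .h = h → σ' .S = frame N S u v w * N →
      σ' .u = u → σ' .v = w → AlignComputes p last s t X r 17 σ') :
    AlignComputes p last s t X r 19 σ := by
  obtain ⟨h₁, h₂, h₃, h₄, h₅, h₆, h₇, h₈, h₉⟩ := hσ
  have hle := hX.edge
  have hdep := hX.depth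
  have hf : frame N S u v w = ((S * N + u) * N + v) * N + w := rfl
  have hN : 0 < N := by omega
  have c₁ := Nat.le_mul_of_pos_right (S * N + u) hN
  have c₂ := Nat.le_mul_of_pos_right ((S * N + u) * N + v) hN
  have c₃ := Nat.le_mul_of_pos_right (frame N S u v w) hN
  refine .mul (S * N) rfl (by simp [*]) (by omega) ?_
  refine .add (S * N + u) rfl (by simp [*]) (by omega) ?_
  refine .mul ((S * N + u) * N) rfl (by simp [*]) (by omega) ?_
  refine .add ((S * N + u) * N + v) rfl (by simp [*]) (by omega) ?_
  refine .mul (((S * N + u) * N + v) * N) rfl (by simp [*]) (by omega) ?_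
  refine .add (frame N S u v w) rfl (by simp [*]) (by omega) ?_
  refine .mul (frame N S u v w * N) rfl (by simp [*]) (by omega) ?_
  refine .copy w rfl (by simp [*]) (by omega) ?_
  refine .sub h rfl (by simp [*]) (by omega) ?_
  exact hnext _ (by constructor <;> simp [*]) (by simp) (by simp) (by simp [*]) (by simp)

/-- The call of the reachability test. -/
theorem computes_call (hX : Large X n p H K N s t) (h : ℕ) {σ : Reg → ℕ} {u v S : ℕ}
    (hσ : Params n p H K N T σ) (hh : σ .h = h) (hH : h ≤ H) (hu : σ .u = u) (hv : σ .v = v)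
    (hS : σ .S = S) (huN : u < N) (hvN : v < N) (hSX : (S + 1) * N ^ (4 * h) ≤ X)
    (hyes : ∀ σ', Params n p H K N T σ' → σ' .h = h → σ' .S = S →
      Savitch (AlignEdge p K s t) N h u v →
      AlignComputes p last s t X r 69 σ')
    (hno : ∀ σ', Params n p H K N T σ' → σ' .h = h → σ' .S = S →
      ¬ Savitch (AlignEdge p K s t) N h u v →
      AlignComputes p last s t X r 54 σ') :
    AlignComputes p last s t X r 17 σ := by
  have hle := hX.edge
  -- The hypotheses `hyes` and `hno` are the continuations after a return. All levels share the
  -- return points `69` and `54`, so only `h` and `S` need to be restored: the caller recovers its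
  -- own data from the stack. The bound `(S + 1) * N ^ (4 * h)` reserves four digits for each of the
  -- `h` levels still to come.
  induction h generalizing σ u v S with
  | zero =>
    refine .branch (q' := (28 : Fin 92)) (q'' := (18 : Fin 92)) rfl (fun _ => ?_) fun h => ?_
    · exact computes_edge hσ hX hh hu hv hS huN hyes hno
    · simp [hh] at h
  | succ h ih =>
    have hframe : ∀ w < N, ∀ x < 2,
        (frame N S u v w * N + x + 1) * N ^ (4 * h) ≤ X := fun w hw x hx => by
      refine le_trans ?_ hSX
      have h₁ := frame_lt (S := S) huN hvN hw
      have h₂ := hX.two_le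
      calc _ ≤ (S + 1) * N ^ 4 * N ^ (4 * h) := Nat.mul_le_mul_right _ (by omega)
        _ = _ := by ring
    have hlt : ∀ w < N, frame N S u v w * N + 1 < X := fun w hw => by
      have := (Nat.le_mul_of_pos_right _ (show 0 < N ^ (4 * h) by
        have := hX.two_le; positivity)).trans (hframe w hw 1 (by omega))
      omega
    -- Loop over the middle vertices: `m` candidates remain, and all those below `w` have failed.
    have htry : ∀ m w σ, m + w = N → 0 < m → Params n p H K N T σ → σ .h = h + 1 → σ .S = S →
        σ .u = u → σ .v = v → σ .w = w →
        (∀ w' < w, ¬ (Savitch (AlignEdge p K s t) N h u w' ∧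
          Savitch (AlignEdge p K s t) N h w' v)) →
        AlignComputes p last s t X r 19 σ := by
      intro m
      induction m with
      | zero => intro _ _ _ h; omega
      | succ m ihm =>
        intro w σ hm _ hσ hh hS hu hv hw hprev
        have hwN : w < N := by omega
        -- The flag `x` tells which half failed; either failure rules out `w`.
        have hfail : ∀ x < 2, ∀ σ', Params n p H K N T σ' → σ' .h = h →
            σ' .S = frame N S u v w * N + x →
            ¬ (Savitch (AlignEdge p K s t) N h u w ∧ Savitch (AlignEdge p K s t) N h w v) →
            AlignComputes p last s t X r 54 σ' := by
          intro x hx σ' hσ' hh' hS' hnot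
          have hprev' : ∀ w' < w + 1, ¬ (Savitch (AlignEdge p K s t) N h u w' ∧
              Savitch (AlignEdge p K s t) N h w' v) := fun w' hw' => by
            rcases Nat.lt_succ_iff_lt_or_eq.1 hw' with h | rfl
            · exact hprev w' h
            · exact hnot
          have hSX' : frame N S u v w < X := by
            have := Nat.le_mul_of_pos_right (frame N S u v w) (show 0 < N by omega)
            have := hlt w hwN
            omega
          refine computes_fail hσ' hX hh' hH (hx.trans_le hX.two_le) hS' huN hvN hwN hSX' ?_ ?_
          · intro σ₂ hσ₂ hh₂ hS₂ hu₂ hv₂ hw₂ hlt₂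
            exact ihm (w + 1) σ₂ (by omega) (by omega) hσ₂ hh₂ hS₂ hu₂ hv₂ hw₂ hprev'
          · intro σ₂ hσ₂ hh₂ hS₂ hwN'
            refine hno σ₂ hσ₂ hh₂ hS₂ ?_
            rintro ⟨w', hw', hsav⟩
            exact hprev' w' (hwN' ▸ hw') hsav
        refine computes_push hσ hX hh hH hS hu hv hw hwN (hlt w hwN) ?_
        intro σ₁ hσ₁ hh₁ hS₁ hu₁ hv₁
        refine ih hσ₁ hh₁ (by omega) hu₁ hv₁ hS₁ huN hwN (hframe w hwN 0 (by omega)) ?_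
          fun σ₂ hσ₂ hh₂ hS₂ hn => hfail 0 (by omega) σ₂ hσ₂ hh₂ hS₂ fun h' => hn h'.1
        intro σ₂ hσ₂ hh₂ hS₂ hsav₁
        refine computes_half hσ₂ hX hh₂ hH hS₂ hvN hwN (hlt w hwN) ?_
        intro σ₃ hσ₃ hh₃ hS₃ hu₃ hv₃
        refine ih hσ₃ hh₃ (by omega) hu₃ hv₃ hS₃ hwN hvN (hframe w hwN 1 (by omega)) ?_
          fun σ₄ hσ₄ hh₄ hS₄ hn => hfail 1 (by omega) σ₄ hσ₄ hh₄ hS₄ fun h' => hn h'.2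
        intro σ₄ hσ₄ hh₄ hS₄ hsav₂
        refine computes_done hσ₄ hX hh₄ hH hS₄ huN hvN hwN (hlt w hwN) ?_
        intro σ₅ hσ₅ hh₅ hS₅
        exact hyes σ₅ hσ₅ hh₅ hS₅ ⟨w, hwN, hsav₁, hsav₂⟩
    refine .branch (q' := (28 : Fin 92)) (q'' := (18 : Fin 92)) rfl (fun h => ?_) fun _ => ?_
    · simp [hh, hσ.zero_eq] at h
    refine .const 0 rfl (by omega) ?_
    obtain ⟨h₁, h₂, h₃, h₄, h₅, h₆, h₇, h₈, h₉⟩ := hσ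
    exact htry N 0 _ (by omega) (by omega) (by constructor <;> simp [*]) (by simp [*])
      (by simp [*]) (by simp [*]) (by simp [*]) (by simp) (by simp)

/-- The search for the least cost. -/
theorem computes_search (hX : Large X n p H K N s t) (hp : p ≤ 2) (hs : s.length = n)
    (ht : t.length = n) (hH : 2 * n ≤ 2 ^ H) (hK : 2 * 2 ^ H < K) (hN : K * K * K = N)
    (hNX : N ^ (4 * H) ≤ X) {c₀ : ℕ} (hc₀ : IsLeast {c | Align p s t c} c₀) (hc₀n : c₀ ≤ 2 * n)
    (hlast : ∀ σ, Params n p H K N T σ → σ .out = c₀ / p →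
      AlignComputes p last s t X r 90 σ)
    (hT : T = n * (K * K + K) + c₀)
    (m c : ℕ) (hm : c + m = c₀) {σ : Reg → ℕ}
    (hσ : Params n p H K N (n * (K * K + K) + c) σ) :
    AlignComputes p last s t X r 13 σ := by
  have hle := hX.edge
  have hdep := hX.depth
  -- The target code fits because `2 * (n + 1) ≤ K` and `K * K + K ≤ 2 * (K * K)`.
  have hcode : ∀ c ≤ c₀, n * (K * K + K) + c < N := fun c hc => by
    have h₁ : n * (K * K + K) + c ≤ n * (K * K + K) + K := by omega
    have h₂ : (n + 1) * (K * K + K) ≤ K * (K * K) := by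
      have := Nat.one_le_two_pow (n := H)
      have : (2 * (n + 1)) * (K * K) ≤ K * (K * K) := Nat.mul_le_mul_right _ (by omega)
      have : K ≤ K * K := Nat.le_mul_self K
      nlinarith
    have h₃ : 0 < K * K := Nat.mul_pos (by omega) (by omega)
    rw [← hN, Nat.mul_assoc]
    rw [Nat.succ_mul] at h₂
    omega
  have hiff : ∀ c ≤ c₀, (Savitch (AlignEdge p K s t) N H 0 (n * (K * K + K) + c) ↔
      Align p s t c) := fun c hc =>
    savitch_alignEdge_iff hp hs ht hH hK (by omega) (hcode c hc)
  -- Here `m` is the distance of the tested cost `c` from the optimum. A positive answer with `m >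
  -- 0` would contradict minimality, and `m = 0` must succeed.
  induction m generalizing c σ with
  | zero =>
    obtain rfl : c = c₀ := by omega
    obtain rfl := hT
    obtain ⟨h₁, h₂, h₃, h₄, h₅, h₆, h₇, h₈, h₉⟩ := hσ
    have hc := hcode c le_rfl
    refine .copy H rfl h₅ hdep ?_
    refine .const 0 rfl (by omega) ?_
    refine .copy (n * (K * K + K) + c) rfl (by simp [*]) (by omega) ?_
    refine .const 0 rfl (by omega) ?_
    refine computes_call (S := 0) (u := 0) hX H (T := n * (K * K + K) + c)
      (by constructor <;> simp [*]) (by simp) le_rfl (by simp) (v := n * (K * K + K) + c)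
      (by simp) (by simp) (by omega) hc (by simpa using hNX) ?_ ?_
    · intro σ' hσ' hh _ _
      obtain ⟨h₁, h₂, h₃, h₄, h₅, h₆, h₇, h₈, h₉⟩ := hσ'
      refine .branch (q' := (86 : Fin 92)) (q'' := (70 : Fin 92)) rfl (fun _ => ?_) fun h => ?_
      swap
      · simp [h₅, hh] at h
      refine .add (K * K + K) rfl (by simp [*]) (by omega) ?_
      refine .mul (n * (K * K + K)) rfl (by simp [*]) (by omega) ?_
      refine .sub c rfl (by simp [*]) (by omega) ?_
      refine .div (c / p) rfl (by simp [*]) ((Nat.div_le_self _ _).trans_lt (by omega)) ?_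
      exact hlast _ (by constructor <;> simp [*]) (by simp)
    · intro σ' _ _ _ hno
      exact absurd ((hiff c le_rfl).2 hc₀.1) hno
  | succ m ih =>
    obtain ⟨h₁, h₂, h₃, h₄, h₅, h₆, h₇, h₈, h₉⟩ := hσ
    have hc := hcode c (by omega)
    refine .copy H rfl h₅ hdep ?_
    refine .const 0 rfl (by omega) ?_
    refine .copy (n * (K * K + K) + c) rfl (by simp [*]) (by omega) ?_
    refine .const 0 rfl (by omega) ?_
    refine computes_call (S := 0) (u := 0) hX H (T := n * (K * K + K) + c)
      (by constructor <;> simp [*]) (by simp) le_rfl (by simp) (v := n * (K * K + K) + c)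
      (by simp) (by simp) (by omega) hc (by simpa using hNX) ?_ ?_
    · intro σ' _ _ _ hyes
      have := hc₀.2 ((hiff c (by omega)).1 hyes)
      omega
    · intro σ' hσ' hh _ _
      obtain ⟨h₁, h₂, h₃, h₄, h₅, h₆, h₇, h₈, h₉⟩ := hσ'
      refine .branch (q' := (85 : Fin 92)) (q'' := (55 : Fin 92)) rfl (fun _ => ?_) fun h => ?_
      swap
      · simp [h₅, hh] at h
      refine .add (n * (K * K + K) + (c + 1)) rfl (by simp [*, Nat.add_assoc]) (by omega) ?_
      exact ih (c + 1) (by omega) (by constructor <;> simp [*])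

/-- The computation of the parameters. -/
theorem computes_pow (h2nX : 4 * n + 1 < X) (hHX : H < X) (hH : H = Nat.size (2 * n))
    (m h : ℕ) (hm : h + m = H) {σ : Reg → ℕ} (hinp : σ .inp = n) (hone : σ .one = 1)
    (hzero : σ .zero = 0) (hp : σ .p = p) (ha : σ .a = 2 * n) (hP : σ .P = 2 ^ h)
    (hh : σ .H = h)
    (hnext : ∀ σ', σ' .inp = n → σ' .one = 1 → σ' .zero = 0 → σ' .p = p → σ' .H = H →
      σ' .P = 2 ^ H → AlignComputes p last s t X r 7 σ') :
    AlignComputes p last s t X r 4 σ := by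
  -- The loop test `2 ^ h ≤ 2 * n` is equivalent to `h < Nat.size (2 * n)`, so the loop stops
  -- exactly at `h = H`.
  induction m generalizing h σ with
  | zero =>
    obtain rfl : h = H := by omega
    refine .branch (q' := (5 : Fin 92)) (q'' := (7 : Fin 92)) rfl (fun h => ?_) fun h => ?_
    · rw [hP, ha, ← Nat.lt_size, ← hH] at h
      omega
    · exact hnext σ hinp hone hzero hp hh hP
  | succ m ih =>
    have hle : 2 ^ h ≤ 2 * n := by
      rw [← Nat.lt_size]
      omega
    refine .branch (q' := (5 : Fin 92)) (q'' := (7 : Fin 92)) rfl (fun _ => ?_) fun h => ?_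
    · refine .add (2 ^ (h + 1)) rfl (by simp only [hP]; ring) (by rw [pow_succ]; omega) ?_
      refine .add (h + 1) rfl (by simp [*]) (by omega) ?_
      exact ih (h + 1) (by omega) (by simp [*]) (by simp [*]) (by simp [*]) (by simp [*])
        (by simp [*]) (by simp [*]) (by simp [*])
    · rw [hP, ha] at h
      omega

theorem computes_init (hX : Large X n p H K N s t) (hp : p ≤ 2) (hs : s.length = n)
    (ht : t.length = n) (hH : H = Nat.size (2 * n)) (hK : K = 3 * 2 ^ H) (hN : K * K * K = N)
    (hNX : N ^ (4 * H) ≤ X) (hnX : 4 * n + 3 < X)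
    {c₀ : ℕ} (hc₀ : IsLeast {c | Align p s t c} c₀) (hc₀n : c₀ ≤ 2 * n)
    (hlast : ∀ σ, σ .inp = n → σ .out = c₀ / p → AlignComputes p last s t X r 90 σ) :
    AlignComputes p last s t X r 0 (Function.update (fun _ => 0) Reg.inp n) := by
  have hle := hX.edge
  have hlt : 2 * n < 2 ^ H := hH ▸ Nat.lt_size_self _
  refine .const 1 rfl (by omega) ?_
  refine .const p rfl (by omega) ?_
  refine .const 1 rfl (by omega) ?_
  refine .add (2 * n) rfl (by simp; ring) (by omega) ?_
  refine computes_pow (n := n) (H := H) (p := p) (by omega) hX.depth hH H 0 (by omega) (by simp)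
    (by simp) (by simp) (by simp) (by simp) (by simp) (by simp) ?_
  intro σ h₁ h₂ h₃ h₄ h₅ hP
  have hK3 : 2 ^ H + 2 ^ H + 2 ^ H = K := by omega
  have hKK : n * (K * K + K) ≤ N := by
    have h₁ : (2 * n) * (K * K) ≤ K * (K * K) := Nat.mul_le_mul_right _ (by omega)
    have h₂ : K ≤ K * K := Nat.le_mul_self K
    rw [← hN]
    nlinarith
  refine .add (2 ^ H + 2 ^ H) rfl (by simp only [hP]) (by omega) ?_
  refine .add K rfl (by simp [hP, hK3]) (by omega) ?_
  refine .mul (K * K) rfl (by simp) (by omega) ?_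
  refine .mul N rfl (by simp [hN]) (by omega) ?_
  refine .add (K * K + K) rfl (by simp) (by omega) ?_
  refine .mul (n * (K * K + K)) rfl (by simp [h₁]) (by omega) ?_
  exact computes_search hX hp hs ht (by omega) (by omega) hN hNX hc₀ hc₀n
    (fun σ hσ => hlast σ hσ.inp_eq) rfl c₀ 0 (by omega) (by constructor <;> simp [*])

/-! ### Memory bound and conclusion -/

/-- The exponent of `n + 2` is `O(L)` since `Nat.size (2 * n) ≤ L + 2`, and `n + 2` itself has at
most `L + 1` bits. The constant comes from `60 * L + 150 + k ≤ (210 + k) * L` and `L + 1 ≤ 2 * L`.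
-/
theorem size_bound_le {n k L N : ℕ} (hL : L = Nat.log 2 (n + 2))
    (hN : N ≤ (n + 2) ^ 15) :
    Nat.size (N ^ (4 * Nat.size (2 * n) + 2) * (n + 2) ^ k) ≤ (420 + 2 * k) * L ^ 2 := by
  have hL1 : 1 ≤ L := hL ▸ Nat.log_pos (by norm_num) (by omega)
  have hn : n + 2 < 2 ^ (L + 1) := hL ▸ Nat.lt_pow_succ_log_self (by norm_num) _
  have hH : Nat.size (2 * n) ≤ L + 2 := Nat.size_le.2 (by rw [pow_succ]; omega)
  generalize Nat.size (2 * n) = H at *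
  rw [Nat.size_le]
  calc N ^ (4 * H + 2) * (n + 2) ^ k
      ≤ ((n + 2) ^ 15) ^ (4 * H + 2) * (n + 2) ^ k :=
        Nat.mul_le_mul_right _ (Nat.pow_le_pow_left hN _)
    _ = (n + 2) ^ (15 * (4 * H + 2) + k) := by rw [← pow_mul, ← pow_add]
    _ < (2 ^ (L + 1)) ^ (15 * (4 * H + 2) + k) := Nat.pow_lt_pow_left hn (by omega)
    _ = 2 ^ ((L + 1) * (15 * (4 * H + 2) + k)) := by rw [← pow_mul]
    _ ≤ 2 ^ ((420 + 2 * k) * L ^ 2) := by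
      refine Nat.pow_le_pow_right (by norm_num) ?_
      have h₁ : 15 * (4 * H + 2) + k ≤ (210 + k) * L := by nlinarith [Nat.le_mul_of_pos_right k hL1]
      calc (L + 1) * (15 * (4 * H + 2) + k) ≤ (2 * L) * ((210 + k) * L) :=
            Nat.mul_le_mul (by omega) h₁
        _ = (420 + 2 * k) * L ^ 2 := by ring

theorem computesWithin {k : ℕ} (hp : p ≤ 2) (hs : s.length = n) (ht : t.length = n)
    (hsk : ∀ c ∈ s, c < (n + 2) ^ k) (htk : ∀ c ∈ t, c < (n + 2) ^ k)
    {c₀ : ℕ} (hc₀ : IsLeast {c | Align p s t c} c₀) (hc₀n : c₀ ≤ 2 * n)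
    (hlast : ∀ X σ, 2 * n < X → σ .inp = n → σ .out = c₀ / p → AlignComputes p last s t X r 90 σ) :
    (alignMachine p last).ComputesWithin s t r
      (20 * (420 + 2 * k) * Nat.log 2 (n + 2) ^ 2) := by
  obtain ⟨H, hH⟩ : ∃ H, H = Nat.size (2 * n) := ⟨_, rfl⟩
  obtain ⟨K, hK⟩ : ∃ K, K = 3 * 2 ^ H := ⟨_, rfl⟩
  obtain ⟨N, hN⟩ : ∃ N, K * K * K = N := ⟨_, rfl⟩
  have hlt : 2 * n < 2 ^ H := hH ▸ Nat.lt_size_self _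
  have hHlt : H < 2 ^ H := Nat.lt_two_pow_self
  have hP : 2 ^ H ≤ 4 * n + 1 := by
    rcases Nat.eq_zero_or_pos H with h | h
    · simp [h]
    · have : 2 ^ (H - 1) ≤ 2 * n := Nat.lt_size.1 (by omega)
      have h2 : 2 ^ H = 2 ^ (H - 1) * 2 := by rw [← pow_succ]; congr 1; omega
      omega
  have h3K : 3 ≤ K := by omega
  have hKK : 3 * K ≤ K * K := Nat.mul_le_mul_right _ h3K
  have hKN : 3 * (K * K) ≤ N := by
    rw [← hN, Nat.mul_assoc]
    exact Nat.mul_le_mul_right _ h3K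
  have hNle : N ≤ (n + 2) ^ 15 := by
    -- From `2 ^ H ≤ 4 * n + 1` follows `K ≤ 16 * (n + 2)`, and `16 ≤ (n + 2) ^ 4`.
    have hK5 : K ≤ (n + 2) ^ 5 := by
      have : 2 ^ 4 ≤ (n + 2) ^ 4 := Nat.pow_le_pow_left (by omega) _
      calc K ≤ 2 ^ 4 * (n + 2) := by omega
        _ ≤ (n + 2) ^ 4 * (n + 2) := Nat.mul_le_mul_right _ this
        _ = (n + 2) ^ 5 := by ring
    calc N = K ^ 3 := by rw [← hN]; ring
      _ ≤ ((n + 2) ^ 5) ^ 3 := Nat.pow_le_pow_left hK5 3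
      _ = (n + 2) ^ 15 := by ring
  -- `N ^ (4 * H)` holds the full stack, two more factors `N` leave room for the arithmetic on
  -- vertices, and `(n + 2) ^ k` covers the characters.
  obtain ⟨X, hX⟩ : ∃ X, X = N ^ (4 * H + 2) * (n + 2) ^ k := ⟨_, rfl⟩
  have hNpos : 0 < N := by omega
  have hk : 0 < (n + 2) ^ k := by positivity
  have hNX : N ^ (4 * H + 2) ≤ X := hX ▸ Nat.le_mul_of_pos_right _ hk
  have hNNX : N * N ≤ X := by
    rw [← pow_two]
    exact (Nat.pow_le_pow_right hNpos (by omega)).trans hNX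
  have h27 : 27 * N ≤ N * N := Nat.mul_le_mul_right _ (by omega)
  have hkX : (n + 2) ^ k ≤ X := hX ▸ Nat.le_mul_of_pos_left _ (by positivity)
  have hchar : ∀ l : List ℕ, (∀ c ∈ l, c < (n + 2) ^ k) → ∀ i, l.getD i 0 < X := by
    intro l hl i
    refine lt_of_lt_of_le ?_ hkX
    by_cases hi : i < l.length
    · rw [List.getD_eq_getElem _ _ hi]
      exact hl _ (List.getElem_mem hi)
    · rw [List.getD_eq_default _ _ (by omega)]
      exact hk
  have hLarge : Large X n p H K N s t :=
    ⟨by omega, by omega, by omega, hchar s hsk, hchar t htk⟩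
  have hcomp := computes_init (last := last) hLarge hp hs ht hH hK hN
    ((Nat.pow_le_pow_right hNpos (by omega)).trans hNX) (by omega) hc₀ hc₀n
    fun σ => hlast X σ (by omega)
  have hwithin := Computes.computesWithin (M := alignMachine p last) (s := s) (t := t) (X := X)
    (v := r) (by rw [hs]; exact hcomp) (by omega)
  have hsize : Nat.size X ≤ (420 + 2 * k) * Nat.log 2 (n + 2) ^ 2 := by
    rw [hX, hH]
    exact size_bound_le rfl hNle
  refine ⟨hwithin.1, fun c hc => (hwithin.2 c hc).trans ?_⟩
  rw [Nat.mul_assoc]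
  exact Nat.mul_le_mul (le_of_eq rfl) hsize

end alignMachine

theorem mainTheorem5 :
    ∃ M₁ M₂ : Machine, ∀ k : ℕ, ∃ C : ℕ, ∀ (n : ℕ) (s t : List ℕ),
      s.length = n → t.length = n →
      (∀ c ∈ s, c < (n + 2) ^ k) → (∀ c ∈ t, c < (n + 2) ^ k) →
      M₁.ComputesWithin s t (lcs s t) (C * Nat.log 2 (n + 2) ^ 2) ∧
      M₂.ComputesWithin s t (ed s t) (C * Nat.log 2 (n + 2) ^ 2) := by
  -- For `p = 2` the optimum `c` satisfies `2 * lcs s t + c = 2 * n`, so the output is `n - c / 2`.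
  -- For `p = 1` the cost is already the answer and the last instruction changes nothing. The factor
  -- `20` is the number of registers.
  refine ⟨alignMachine 2 (.sub .out .inp .out 91), alignMachine 1 (.copy .out .out 91), fun k =>
    ⟨20 * (420 + 2 * k), fun n s t hs ht hsk htk => ⟨?_, ?_⟩⟩⟩
  · obtain ⟨c, hc, hlcs⟩ := isLeast_align_lcs s t
    have hle := lcs_le_length_left s t
    refine alignMachine.computesWithin le_rfl hs ht hsk htk hc (by omega)
      fun X σ hX hinp hout => .sub (lcs s t) rfl ?_ (by omega) (.halt rfl (by simp))
    rw [hinp, hout]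
    omega
  · have hed := isLeast_align_ed s t
    have hle : ed s t ≤ 2 * n := by
      have h : Align 1 s t (s.length + t.length) := by
        simpa using (Align.nil_right 1 s).append (Align.nil_left 1 t)
      have := hed.2 h
      omega
    refine alignMachine.computesWithin one_le_two hs ht hsk htk hed hle
      fun X σ hX hinp hout => .copy (ed s t) rfl ?_ ?_ (.halt rfl (by simp))
    · rw [hout, Nat.div_one]
    · omega
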